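/- Let $G$ be a finite simple connected graph with $m$ edges, and let the lengths $\xi_e$ ($e\in E(G)$) be independent random variables, each uniformly distributed on $[0,1]$. Let $L(G)=\sum_{e\in E(\mathrm{MST}(G))}\xi_e$ be the total length of a minimal spanning tree of $G$, that is, of a spanning tree for which the sum of the lengths of the edges is smallest. Let $S(G)$ be the set of all spanning subgraphs of $G$ (the subgraphs with vertex set $V(G)$ and edge set any subset of $E(G)$). For $A\in S(G)$ let $|A|$ be its number of edges and $k(A)$ its number of connected components, and let $S_\ell=\{A\in S(G): |A|=\ell\}$. Put \[ p_m(t)=\sum_{A\in S(G)}k(A)\,t^{|A|}(1-t)^{m-|A|}-1 . \] Then $L(G)$ is integrable and \[ \mathbb{E}[L(G)]=\int_0^1 p_m(t)\,dt . \] Moreover, $p_m$ is a polynomial in $t$ of degree at most $m$, and \[ p_m(t)=-1+\sum_{i=0}^m a_i t^i,\qquad a_i=\sum_{\ell=0}^i(-1)^{i-\ell}\binom{m-\ell}{m-i}\sum_{A\in S_\ell}k(A)\quad(0\le i\le m). \] -/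

import Mathlib

namespace SimpleGraph

open Polynomial

section MinimalSpanningTree

variable {V : Type*} [Fintype V]

open scoped Classical in
/-- The sum of the edge lengths `w e` over those edges `e` of `G` that belong to `T`. -/
noncomputable def totalLength (G : SimpleGraph V) (w : G.edgeSet → ℝ) (T : SimpleGraph V) : ℝ :=
  ∑ e ∈ Finset.univ.filter (fun e : G.edgeSet => (e : Sym2 V) ∈ T.edgeSet), w e

/-- `T` is a spanning tree of `G` (on the whole vertex set `V`). -/
def IsSpanningTree (G T : SimpleGraph V) : Prop :=
  T ≤ G ∧ T.IsTree

/-- `T` is a minimal spanning tree of `G` for the edge lengths `w`. -/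
def IsMST (G : SimpleGraph V) (w : G.edgeSet → ℝ) (T : SimpleGraph V) : Prop :=
  G.IsSpanningTree T ∧ ∀ T', G.IsSpanningTree T' → G.totalLength w T ≤ G.totalLength w T'

theorem exists_isMST (G : SimpleGraph V) (hG : G.Connected) (w : G.edgeSet → ℝ) :
    ∃ T, G.IsMST w T := by
  obtain ⟨T₀, hT₀⟩ := hG.exists_isTree_le
  obtain ⟨T, hT, hmin⟩ := Set.exists_min_image {T | G.IsSpanningTree T} (G.totalLength w)
    (Set.toFinite _) ⟨T₀, hT₀⟩
  exact ⟨T, hT, hmin⟩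

/-- A minimal spanning tree of the connected graph `G` for the edge lengths `w`
(if there are several, any one of them). -/
noncomputable def mst (G : SimpleGraph V) (hG : G.Connected) (w : G.edgeSet → ℝ) :
    SimpleGraph V :=
  (G.exists_isMST hG w).choose

/-- The total length of a minimal spanning tree of `G` for the edge lengths `w`. -/
noncomputable def mstLength (G : SimpleGraph V) (hG : G.Connected) (w : G.edgeSet → ℝ) : ℝ :=
  G.totalLength w (G.mst hG w)

/-- `mstLength` does not depend on the choice of the minimal spanning tree. -/
theorem mstLength_eq (G : SimpleGraph V) (hG : G.Connected) (w : G.edgeSet → ℝ)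
    (T : SimpleGraph V) (hT : G.IsMST w T) : G.mstLength hG w = G.totalLength w T :=
  have h := (G.exists_isMST hG w).choose_spec
  le_antisymm (h.2 T hT.1) (hT.2 _ h.1)

end MinimalSpanningTree

section Polynomial

variable {V : Type*} [Fintype V]

/-- The number of edges. -/
noncomputable def numEdges (G : SimpleGraph V) : ℕ :=
  G.edgeSet.ncard

/-- The number of connected components. -/
noncomputable def numComponents (G : SimpleGraph V) : ℕ :=
  Nat.card G.ConnectedComponent

open scoped Classical in
/-- The set of spanning subgraphs of `G`: vertex set `V`, edge set contained in that of `G`. -/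
noncomputable def spanningSubgraphs (G : SimpleGraph V) : Finset (SimpleGraph V) :=
  {A | A ≤ G}

open scoped Classical in
/-- The set of spanning subgraphs of `G` with exactly `l` edges. -/
noncomputable def spanningSubgraphsCard (G : SimpleGraph V) (l : ℕ) : Finset (SimpleGraph V) :=
  {A ∈ G.spanningSubgraphs | A.numEdges = l}

/-- The polynomial `∑ k(A) X^|A| (1 - X)^(m - |A|) - 1`, the sum being over all spanning
subgraphs `A` of `G`, where `m` is the number of edges of `G`. -/
noncomputable def mstPolynomial (G : SimpleGraph V) : ℝ[X] :=
  ∑ A ∈ G.spanningSubgraphs,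
    C (A.numComponents : ℝ) * X ^ A.numEdges * (1 - X) ^ (G.numEdges - A.numEdges) - 1

/-- The number `a_i = ∑_{l ≤ i} (-1)^(i-l) C(m-l, m-i) ∑_{A : |A| = l} k(A)`, used for `i ≤ m`. -/
noncomputable def mstCoeff (G : SimpleGraph V) (i : ℕ) : ℝ :=
  ∑ l ∈ Finset.range (i + 1), (-1 : ℝ) ^ (i - l) *
    ((G.numEdges - l).choose (G.numEdges - i) : ℝ) *
      ∑ A ∈ G.spanningSubgraphsCard l, (A.numComponents : ℝ)

end Polynomial

end SimpleGraph

/-! For a level `t`, let `Γ_t` (`sublevelGraph`) consist of the edges of length at most `t`. If `T`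
is a minimal spanning tree, an exchange argument shows that `T ⊓ Γ_t` has the same components as
`Γ_t` (`IsMST.reachable_sublevelGraph_iff`). Deleting `s` edges from a tree leaves `s + 1`
components, so `T` has exactly `k(Γ_t) - 1` edges longer than `t`
(`IsMST.numComponents_sublevelGraph`).

A length `x` in `[0,1]` is the integral over `t ∈ [0,1]` of the indicator of `x > t`. Summing over
the edges of `T` gives `L = ∫ (k(Γ_t) - 1) dt` (`mstLength_eq_integral`).

By Fubini it remains to average `k(Γ_t) - 1` at a fixed `t`. Each edge lies in `Γ_t` independently
with probability `t`, so `Γ_t = A` has probability `t^|A| (1-t)^(m-|A|)`, and the average is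
`p_m(t)` (`integral_numComponents_sublevelGraph`). The coefficients come from the binomial theorem.
-/

namespace SimpleGraph

open Polynomial

/-! ### Counting components after deleting edges of a tree. -/

section Components

variable {V : Type*}

/-- Removing an edge `s(u, v)` splits at most one connected component, into the component
of `u` and that of `v`. -/
theorem Reachable.deleteEdges_singleton {H : SimpleGraph V} {u v x y : V}
    (h : H.Reachable x y) :
    (H.deleteEdges {s(u, v)}).Reachable x y ∨
      ((H.deleteEdges {s(u, v)}).Reachable x u ∧ (H.deleteEdges {s(u, v)}).Reachable v y) ∨
      ((H.deleteEdges {s(u, v)}).Reachable x v ∧ (H.deleteEdges {s(u, v)}).Reachable u y) := by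
  obtain ⟨p⟩ := h
  induction p with
  | nil => exact Or.inl (Reachable.refl _)
  | @cons a b c hab p ih =>
    by_cases he : s(a, b) = s(u, v)
    · rcases Sym2.eq_iff.1 he with ⟨rfl, rfl⟩ | ⟨rfl, rfl⟩
      · rcases ih with ih | ⟨-, ih⟩ | ⟨-, ih⟩
        · exact Or.inr (Or.inl ⟨Reachable.refl _, ih⟩)
        · exact Or.inr (Or.inl ⟨Reachable.refl _, ih⟩)
        · exact Or.inl ih
      · rcases ih with ih | ⟨-, ih⟩ | ⟨-, ih⟩
        · exact Or.inr (Or.inr ⟨Reachable.refl _, ih⟩)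
        · exact Or.inl ih
        · exact Or.inr (Or.inr ⟨Reachable.refl _, ih⟩)
    · have hab' : (H.deleteEdges {s(u, v)}).Reachable a b :=
        Adj.reachable (by simpa [deleteEdges_adj] using ⟨hab, by simpa using he⟩)
      rcases ih with ih | ⟨h1, h2⟩ | ⟨h1, h2⟩
      · exact Or.inl (hab'.trans ih)
      · exact Or.inr (Or.inl ⟨hab'.trans h1, h2⟩)
      · exact Or.inr (Or.inr ⟨hab'.trans h1, h2⟩)

theorem numComponents_deleteEdges_singleton [Finite V] {H : SimpleGraph V} {e : Sym2 V}
    (he : e ∈ H.edgeSet) (hb : H.IsBridge e) :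
    (H.deleteEdges {e}).numComponents = H.numComponents + 1 := by
  induction e using Sym2.ind with
  | _ u v =>
  set D := H.deleteEdges {s(u, v)} with hD
  have huv : ¬ D.Reachable u v := isBridge_iff.1 hb
  let f : D.ConnectedComponent → H.ConnectedComponent :=
    ConnectedComponent.map (Hom.ofLE (deleteEdges_le _))
  have hf : ∀ x, f (D.connectedComponentMk x) = H.connectedComponentMk x := fun x => rfl
  -- The components of `u` and `v` in `D` have the same image under `f`, and no other two are
  -- merged; so leaving out that of `v` makes `f` bijective.
  have himg : f '' {D.connectedComponentMk v}ᶜ = Set.univ := by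
    refine Set.eq_univ_of_forall fun c => ?_
    induction c using ConnectedComponent.ind with
    | _ x =>
    by_cases hx : D.Reachable x v
    · refine ⟨D.connectedComponentMk u, by simpa [ConnectedComponent.eq] using huv, ?_⟩
      rw [hf, ConnectedComponent.eq]
      exact (Adj.reachable he).trans (hx.mono (deleteEdges_le _)).symm
    · exact ⟨D.connectedComponentMk x, by simpa [ConnectedComponent.eq] using hx, hf x⟩
  have hinj : Set.InjOn f {D.connectedComponentMk v}ᶜ := by
    intro c hc d hd hcd
    induction c using ConnectedComponent.ind with
    | _ x =>
    induction d using ConnectedComponent.ind with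
    | _ y =>
    simp only [Set.mem_compl_iff, Set.mem_singleton_iff, ConnectedComponent.eq] at hc hd
    rw [hf, hf, ConnectedComponent.eq] at hcd
    rw [ConnectedComponent.eq]
    rcases hcd.deleteEdges_singleton (u := u) (v := v) with h | ⟨-, h⟩ | ⟨h, -⟩
    · exact h
    · exact absurd h.symm hd
    · exact absurd h hc
  have h1 := hinj.ncard_image
  rw [himg, Set.ncard_univ] at h1
  have h2 := Set.ncard_add_ncard_compl {D.connectedComponentMk v}
  rw [Set.ncard_singleton] at h2
  unfold numComponents
  omega

theorem IsTree.numComponents_eq_one {T : SimpleGraph V} (hT : T.IsTree) :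
    T.numComponents = 1 := by
  have := hT.connected.preconnected.subsingleton_connectedComponent
  have := hT.connected.nonempty
  exact Nat.card_unique

/-- Every edge of a forest is a bridge, and what remains after each deletion is still a forest, so
each deletion adds one component. -/
theorem IsTree.numComponents_deleteEdges [Finite V] {T : SimpleGraph V} (hT : T.IsTree)
    (S : Finset (Sym2 V)) (hS : ↑S ⊆ T.edgeSet) :
    (T.deleteEdges ↑S).numComponents = S.card + 1 := by
  classical
  induction S using Finset.induction_on with
  | empty => simpa using hT.numComponents_eq_one
  | insert e S he ih =>
    have hS' : ↑S ⊆ T.edgeSet := fun x hx => hS (by simpa using Or.inr hx)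
    have heS : e ∈ (T.deleteEdges ↑S).edgeSet := by
      rw [edgeSet_deleteEdges]
      exact ⟨hS (by simp), by simpa using he⟩
    have hb : (T.deleteEdges ↑S).IsBridge e :=
      (isAcyclic_iff_forall_isBridge.1 (hT.isAcyclic.anti (deleteEdges_le _))) heS
    have := numComponents_deleteEdges_singleton heS hb
    rw [deleteEdges_deleteEdges] at this
    rw [Finset.card_insert_of_notMem he, ← ih hS', ← this]
    congr 2
    ext x
    simp

theorem numComponents_congr {H K : SimpleGraph V} (h : ∀ x y, H.Reachable x y ↔ K.Reachable x y) :
    H.numComponents = K.numComponents :=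
  Nat.card_congr (Quot.congrRight h)

end Components

/-! ### Minimal spanning trees and sublevel graphs. -/

section Sublevel

variable {V : Type*}

/-- The spanning subgraph of `G` formed by the edges of length at most `t`. -/
def sublevelGraph (G : SimpleGraph V) (w : G.edgeSet → ℝ) (t : ℝ) : SimpleGraph V :=
  fromEdgeSet {e | ∃ h : e ∈ G.edgeSet, w ⟨e, h⟩ ≤ t}

theorem edgeSet_sublevelGraph (G : SimpleGraph V) (w : G.edgeSet → ℝ) (t : ℝ) :
    (G.sublevelGraph w t).edgeSet = {e | ∃ h : e ∈ G.edgeSet, w ⟨e, h⟩ ≤ t} := by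
  rw [sublevelGraph, edgeSet_fromEdgeSet, sdiff_eq_left, Set.disjoint_left]
  rintro e ⟨h, -⟩ hd
  exact G.not_isDiag_of_mem_edgeSet h hd

theorem sublevelGraph_le (G : SimpleGraph V) (w : G.edgeSet → ℝ) (t : ℝ) :
    G.sublevelGraph w t ≤ G := by
  rw [← edgeSet_subset_edgeSet, edgeSet_sublevelGraph]
  exact fun e h => h.1

/-- Exchanging an edge of a spanning tree for another one that closes a cycle with it. -/
theorem IsTree.exchange [Finite V] {T : SimpleGraph V} (hT : T.IsTree) {u v a b : V} (huv : u ≠ v)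
    (hnadj : ¬ T.Adj u v) {p : T.Walk u v} (hp : p.IsPath) (hab : s(a, b) ∈ p.edges) :
    ((T ⊔ edge u v).deleteEdges {s(a, b)}).IsTree := by
  classical
  have hE : (T ⊔ edge u v).edgeSet = insert s(u, v) T.edgeSet := by
    rw [edgeSet_sup, edgeSet_edge_of_ne huv, Set.union_comm, Set.singleton_union]
  have habT : s(a, b) ∈ T.edgeSet := p.edges_subset_edgeSet hab
  have huvT : s(u, v) ∉ T.edgeSet := hnadj
  rw [isTree_iff_connected_and_card]
  have hvu : (T ⊔ edge u v).Adj v u := by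
    rw [adj_comm, ← mem_edgeSet, hE]; simp
  -- The new edge closes the path `p` to a cycle through `s(a, b)`, which is therefore not a bridge:
  -- deleting it keeps the graph connected, and the edge count is again that of `T`.
  have hcyc : (Walk.cons hvu (p.mapLe le_sup_left)).IsCycle := by
    rw [Walk.cons_isCycle_iff]
    refine ⟨hp.mapLe _, fun h => huvT ?_⟩
    rw [Walk.edges_mapLe_eq_edges, Sym2.eq_swap] at h
    exact p.edges_subset_edgeSet h
  have hnb : ¬ (T ⊔ edge u v).IsBridge s(a, b) := fun hb =>
    hb.notMem_edges_of_isCycle hcyc (by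
      rw [Walk.edges_cons, Walk.edges_mapLe_eq_edges]
      exact List.mem_cons_of_mem _ hab)
  refine ⟨(hT.connected.mono le_sup_left).connected_delete_edge_of_not_isBridge hnb, ?_⟩
  rw [← (isTree_iff_connected_and_card.1 hT).2, edgeSet_deleteEdges, hE,
    Nat.card_coe_set_eq, Nat.card_coe_set_eq,
    Set.ncard_sdiff_singleton_of_mem (Set.mem_insert_of_mem _ habT),
    Set.ncard_insert_of_notMem huvT]
  rfl

open scoped Classical in
/-- Exchanging the edge `f` for the edge `e` changes the length by `w e - w f`. -/
theorem totalLength_exchange [Fintype V] (G : SimpleGraph V) (w : G.edgeSet → ℝ) {T T' : SimpleGraph V}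
    (e f : G.edgeSet) (he : (e : Sym2 V) ∉ T.edgeSet) (hf : (f : Sym2 V) ∈ T.edgeSet)
    (hT' : T'.edgeSet = insert (e : Sym2 V) T.edgeSet \ {(f : Sym2 V)}) :
    G.totalLength w T' + w f = G.totalLength w T + w e := by
  have hef : e ≠ f := by rintro rfl; exact he hf
  unfold totalLength
  have h1 : (Finset.univ.filter fun x : G.edgeSet => (x : Sym2 V) ∈ T'.edgeSet) =
      (insert e (Finset.univ.filter fun x : G.edgeSet => (x : Sym2 V) ∈ T.edgeSet)).erase f := by
    ext x
    simp [hT', Subtype.ext_iff, and_comm]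
  rw [h1, Finset.sum_erase_add _ _ (by simp [hf]), Finset.sum_insert (by simp [he]), add_comm]

/-- The edges of length at most `t` of a minimal spanning tree connect the same vertices
as all edges of length at most `t`. -/
theorem IsMST.reachable_sublevelGraph_iff [Fintype V] {G T : SimpleGraph V} {w : G.edgeSet → ℝ}
    (hT : G.IsMST w T) (t : ℝ) (x y : V) :
    (T ⊓ G.sublevelGraph w t).Reachable x y ↔ (G.sublevelGraph w t).Reachable x y := by
  classical
  refine ⟨fun h => h.mono inf_le_right, ?_⟩
  rintro ⟨q⟩
  induction q with
  | nil => exact Reachable.refl _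
  | @cons u v c huv q ih =>
    refine Reachable.trans ?_ ih
    by_cases hTuv : T.Adj u v
    · exact Adj.reachable ⟨hTuv, huv⟩
    obtain ⟨p, hp⟩ := hT.1.2.connected.exists_isPath u v
    by_cases hall : ∀ e ∈ p.edges, e ∈ (T ⊓ G.sublevelGraph w t).edgeSet
    · exact ⟨p.transfer _ hall⟩
    -- Some edge `f` of the tree path is longer than `t`; exchanging it for `s(u, v)`, of length at
    -- most `t`, would give a strictly shorter spanning tree.
    exfalso
    push Not at hall
    obtain ⟨f, hfp, hf⟩ := hall
    have hfT := p.edges_subset_edgeSet hfp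
    have hfG : f ∈ G.edgeSet := edgeSet_mono hT.1.1 hfT
    have hft : t < w ⟨f, hfG⟩ := by
      by_contra! hle
      refine hf ?_
      rw [edgeSet_inf, edgeSet_sublevelGraph]
      exact ⟨hfT, hfG, hle⟩
    have hle : s(u, v) ∈ (G.sublevelGraph w t).edgeSet := huv
    rw [edgeSet_sublevelGraph] at hle
    obtain ⟨heG, het⟩ := hle
    have htree : ((T ⊔ edge u v).deleteEdges {f}).IsTree := by
      induction f using Sym2.ind with
      | _ a b => exact hT.1.2.exchange huv.ne hTuv hp hfp
    have hE : ((T ⊔ edge u v).deleteEdges {f}).edgeSet = insert s(u, v) T.edgeSet \ {f} := by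
      rw [edgeSet_deleteEdges, edgeSet_sup, edgeSet_edge_of_ne huv.ne, Set.union_comm,
        Set.singleton_union]
    have hsp : G.IsSpanningTree ((T ⊔ edge u v).deleteEdges {f}) := by
      refine ⟨?_, htree⟩
      rw [← edgeSet_subset_edgeSet, hE]
      rintro z ⟨rfl | hz, -⟩
      · exact heG
      · exact edgeSet_mono hT.1.1 hz
    have h1 := G.totalLength_exchange w ⟨s(u, v), heG⟩ ⟨f, hfG⟩ hTuv hfT hE
    have h2 := hT.2 _ hsp
    linarith

open scoped Classical in
/-- The number of edges of length more than `t` in a minimal spanning tree. -/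
theorem IsMST.numComponents_sublevelGraph [Fintype V] {G T : SimpleGraph V} {w : G.edgeSet → ℝ}
    (hT : G.IsMST w T) (t : ℝ) :
    ((G.sublevelGraph w t).numComponents : ℝ) - 1 =
      ∑ e ∈ Finset.univ.filter (fun e : G.edgeSet => (e : Sym2 V) ∈ T.edgeSet),
        if w e ≤ t then 0 else 1 := by
  set S : Finset G.edgeSet :=
    (Finset.univ.filter (fun e : G.edgeSet => (e : Sym2 V) ∈ T.edgeSet)).filter
      fun e => ¬ w e ≤ t with hS
  have hsub : (↑(S.map (Function.Embedding.subtype _)) : Set (Sym2 V)) ⊆ T.edgeSet := by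
    intro z hz
    simp only [hS, Finset.coe_map, Set.mem_image, Finset.mem_coe, Finset.mem_filter] at hz
    obtain ⟨e, he, rfl⟩ := hz
    exact he.1.2
  have hdel : T.deleteEdges ↑(S.map (Function.Embedding.subtype _)) =
      T ⊓ G.sublevelGraph w t := by
    rw [← edgeSet_inj, edgeSet_deleteEdges, edgeSet_inf, edgeSet_sublevelGraph]
    ext z
    simp only [hS, Set.mem_sdiff, Finset.coe_map, Set.mem_image, Finset.mem_coe,
      Finset.mem_filter, Finset.mem_univ, true_and, Set.mem_inter_iff, Set.mem_ofPred_eq]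
    refine and_congr_right fun hz => ⟨fun h => ?_, ?_⟩
    · refine ⟨edgeSet_mono hT.1.1 hz, ?_⟩
      by_contra hlt
      exact h ⟨⟨z, edgeSet_mono hT.1.1 hz⟩, ⟨hz, hlt⟩, rfl⟩
    · rintro ⟨h, hle⟩ ⟨e, ⟨-, he⟩, rfl⟩
      exact he hle
  rw [← numComponents_congr (hT.reachable_sublevelGraph_iff t), ← hdel,
    hT.1.2.numComponents_deleteEdges _ hsub, Finset.card_map, hS, Finset.card_filter]
  push_cast
  rw [add_sub_cancel_right]
  exact Finset.sum_congr rfl fun e _ => ite_not _ _ _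

end Sublevel

/-! ### Expansion of the polynomial in powers of `X`. -/

section Coefficients

variable {V : Type*} [Fintype V]

theorem numEdges_le_of_mem_spanningSubgraphs {G A : SimpleGraph V}
    (hA : A ∈ G.spanningSubgraphs) : A.numEdges ≤ G.numEdges := by
  simp only [spanningSubgraphs, Finset.mem_filter] at hA
  exact Set.ncard_le_ncard (edgeSet_mono hA.2) (Set.toFinite _)

theorem X_pow_mul_one_sub_X_pow {l m : ℕ} (hl : l ≤ m) :
    (X ^ l * (1 - X) ^ (m - l) : ℝ[X]) =
      ∑ i ∈ Finset.range (m + 1), if l ≤ i then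
        C ((-1 : ℝ) ^ (i - l) * ((m - l).choose (m - i) : ℝ)) * X ^ i else 0 := by
  have hm : m + 1 = l + (m - l + 1) := by omega
  -- The terms with `i < l` vanish; the others, with `i = l + j`, are the binomial expansion of `(-X
  -- + 1)^(m - l)`.
  rw [hm, Finset.sum_range_add, Finset.sum_eq_zero, zero_add, sub_eq_neg_add, add_pow,
    Finset.mul_sum]
  · refine Finset.sum_congr rfl fun j hj => ?_
    have hj' : j ≤ m - l := by simpa [Nat.lt_succ_iff] using hj
    rw [if_pos (by omega), show l + j - l = j by omega, show m - (l + j) = m - l - j by omega,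
      Nat.choose_symm hj', neg_pow]
    simp only [one_pow, mul_one, map_mul, map_pow, map_neg, map_one, map_natCast, pow_add]
    ring
  · intro i hi
    rw [if_neg (by simpa using hi)]

theorem mstPolynomial_eq (G : SimpleGraph V) :
    G.mstPolynomial =
      -1 + ∑ i ∈ Finset.range (G.numEdges + 1), C (G.mstCoeff i) * X ^ i := by
  classical
  have hcoeff : ∀ i ∈ Finset.range (G.numEdges + 1), C (G.mstCoeff i) * X ^ i =
      ∑ A ∈ G.spanningSubgraphs, C (A.numComponents : ℝ) * (if A.numEdges ≤ i then
        C ((-1 : ℝ) ^ (i - A.numEdges) *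
          ((G.numEdges - A.numEdges).choose (G.numEdges - i) : ℝ)) * X ^ i else 0) := by
    intro i _
    have hmaps : ∀ A ∈ G.spanningSubgraphs.filter (fun A => A.numEdges ≤ i),
        A.numEdges ∈ Finset.range (i + 1) := by
      intro A hA
      simpa [Nat.lt_succ_iff] using (Finset.mem_filter.1 hA).2
    simp only [mul_ite, mul_zero]
    rw [← Finset.sum_filter, ← Finset.sum_fiberwise_of_maps_to hmaps, mstCoeff, map_sum,
      Finset.sum_mul]
    refine Finset.sum_congr rfl fun l hl => ?_
    rw [Finset.filter_filter, map_mul, map_sum, Finset.mul_sum, Finset.sum_mul,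
      spanningSubgraphsCard]
    refine Finset.sum_congr ?_ fun A hA => ?_
    · ext A
      have : l ≤ i := by simpa [Nat.lt_succ_iff] using hl
      simp only [Finset.mem_filter]
      constructor
      · rintro ⟨h1, rfl⟩
        exact ⟨h1, this, rfl⟩
      · rintro ⟨h1, -, h2⟩
        exact ⟨h1, h2⟩
    · rw [← (Finset.mem_filter.1 hA).2.2]
      ring
  rw [mstPolynomial, sub_eq_neg_add, Finset.sum_congr rfl hcoeff, Finset.sum_comm]
  congr 1
  refine Finset.sum_congr rfl fun A hA => ?_
  rw [mul_assoc, X_pow_mul_one_sub_X_pow (numEdges_le_of_mem_spanningSubgraphs hA),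
    Finset.mul_sum]

theorem natDegree_mstPolynomial_le (G : SimpleGraph V) :
    G.mstPolynomial.natDegree ≤ G.numEdges := by
  rw [mstPolynomial_eq]
  refine natDegree_add_le_of_degree_le (by simp) (natDegree_sum_le_of_forall_le _ _ fun i hi => ?_)
  exact (natDegree_C_mul_X_pow_le _ _).trans (by simpa [Nat.lt_succ_iff] using hi)

end Coefficients

/-! ### Integration over levels and over random lengths. -/

section Expectation

open MeasureTheory
open scoped Classical

variable {V : Type*}

/-- The indicator of the event that the sublevel graph at level `t` agrees with `A` at the edge `e`
of length `x`. -/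
noncomputable def edgeIndicator (A : SimpleGraph V) (e : Sym2 V) (x t : ℝ) : ℝ :=
  if e ∈ A.edgeSet then if x ≤ t then 1 else 0 else if x ≤ t then 0 else 1

theorem norm_edgeIndicator_le (A : SimpleGraph V) (e : Sym2 V) (x t : ℝ) :
    ‖A.edgeIndicator e x t‖ ≤ 1 := by
  unfold edgeIndicator
  split_ifs <;> simp

theorem measurable_edgeIndicator (A : SimpleGraph V) (e : Sym2 V) :
    Measurable fun q : ℝ × ℝ => A.edgeIndicator e q.1 q.2 := by
  have hle : MeasurableSet {q : ℝ × ℝ | q.1 ≤ q.2} := measurableSet_le measurable_fst measurable_snd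
  unfold edgeIndicator
  split_ifs
  · exact Measurable.ite hle measurable_const measurable_const
  · exact Measurable.ite hle measurable_const measurable_const

theorem integral_Icc_ite_le {t : ℝ} (ht : t ∈ Set.Icc (0 : ℝ) 1) (a b : ℝ) :
    ∫ x in Set.Icc (0 : ℝ) 1, (if x ≤ t then a else b) = t * a + (1 - t) * b := by
  have hcongr : ∀ x : ℝ, (if x ≤ t then a else b) =
      (Set.Iic t).indicator (fun _ => a - b) x + b := by
    intro x
    by_cases h : x ≤ t <;> simp [h]
  simp only [hcongr]
  rw [integral_add ((integrable_const _).indicator measurableSet_Iic) (integrable_const _),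
    integral_indicator measurableSet_Iic, Measure.restrict_restrict measurableSet_Iic]
  have : Set.Iic t ∩ Set.Icc 0 1 = Set.Icc 0 t := by
    ext x
    simp only [Set.mem_inter_iff, Set.mem_Iic, Set.mem_Icc]
    exact ⟨fun h => ⟨h.2.1, h.1⟩, fun h => ⟨h.2, h.1, h.2.trans ht.2⟩⟩
  rw [this]
  simp [ht.1]
  ring

theorem integral_Icc_ite_ge {x : ℝ} (hx : x ∈ Set.Icc (0 : ℝ) 1) :
    ∫ t in Set.Icc (0 : ℝ) 1, (if x ≤ t then (0 : ℝ) else 1) = x := by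
  have hcongr : ∀ t : ℝ, (if x ≤ t then (0 : ℝ) else 1) =
      (Set.Iio x).indicator (fun _ => 1) t := by
    intro t
    by_cases h : x ≤ t
    · simp [h, not_lt.2 h]
    · simp [h, not_le.1 h]
  simp only [hcongr]
  rw [integral_indicator measurableSet_Iio, Measure.restrict_restrict measurableSet_Iio]
  have : Set.Iio x ∩ Set.Icc 0 1 = Set.Ico 0 x := by
    ext t
    simp only [Set.mem_inter_iff, Set.mem_Iio, Set.mem_Icc, Set.mem_Ico]
    exact ⟨fun h => ⟨h.2.1, h.1⟩, fun h => ⟨h.2, h.1, h.2.le.trans hx.2⟩⟩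
  rw [this]
  simp [hx.1]

theorem integral_edgeIndicator (A : SimpleGraph V) (e : Sym2 V) {t : ℝ}
    (ht : t ∈ Set.Icc (0 : ℝ) 1) :
    ∫ x in Set.Icc (0 : ℝ) 1, A.edgeIndicator e x t = if e ∈ A.edgeSet then t else 1 - t := by
  unfold edgeIndicator
  split_ifs
  · rw [integral_Icc_ite_le ht]; ring
  · rw [integral_Icc_ite_le ht]; ring

variable [Fintype V]

/-- The length of a minimal spanning tree is the integral over all levels of the number of
components of the sublevel graph, minus one. -/
theorem mstLength_eq_integral (G : SimpleGraph V) (hG : G.Connected) {w : G.edgeSet → ℝ}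
    (hw : ∀ e, w e ∈ Set.Icc (0 : ℝ) 1) :
    G.mstLength hG w =
      ∫ t in Set.Icc (0 : ℝ) 1, (((G.sublevelGraph w t).numComponents : ℝ) - 1) := by
  obtain ⟨T, hT⟩ := G.exists_isMST hG w
  rw [G.mstLength_eq hG w T hT]
  simp only [hT.numComponents_sublevelGraph]
  rw [integral_finsetSum, totalLength]
  · exact Finset.sum_congr (by congr) fun e _ => (integral_Icc_ite_ge (hw e)).symm
  · intro e _
    refine Integrable.of_bound (C := 1) (Measurable.aestronglyMeasurable ?_) (.of_forall fun t => ?_)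
    · exact Measurable.ite (measurableSet_le measurable_const measurable_id) measurable_const
        measurable_const
    · split_ifs <;> simp

theorem prod_edgeIndicator (G : SimpleGraph V) (w : G.edgeSet → ℝ) (t : ℝ)
    {A : SimpleGraph V} (hA : A ≤ G) :
    ∏ e : G.edgeSet, A.edgeIndicator e (w e) t = if A = G.sublevelGraph w t then 1 else 0 := by
  have key : ∀ e : G.edgeSet, A.edgeIndicator e (w e) t =
      if ((e : Sym2 V) ∈ A.edgeSet ↔ w e ≤ t) then 1 else 0 := by
    intro e
    unfold edgeIndicator
    split_ifs <;> simp_all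
  simp only [key]
  rw [Fintype.prod_ite_zero]
  simp only [Finset.prod_const_one]
  refine if_congr ?_ rfl rfl
  rw [← edgeSet_inj, edgeSet_sublevelGraph]
  constructor
  · intro h
    ext z
    exact ⟨fun hz => ⟨edgeSet_mono hA hz, (h ⟨z, edgeSet_mono hA hz⟩).1 hz⟩,
      fun ⟨hz, hle⟩ => (h ⟨z, hz⟩).2 hle⟩
  · rintro h ⟨z, hz⟩
    rw [h]
    exact ⟨fun ⟨_, hle⟩ => hle, fun hle => ⟨hz, hle⟩⟩

/-- Only `A = sublevelGraph` contributes. The form as a finite sum of products of one-edge functions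
yields joint measurability and lets independence factor the integral. -/
theorem numComponents_sublevelGraph_eq_sum (G : SimpleGraph V) (w : G.edgeSet → ℝ) (t : ℝ) :
    ((G.sublevelGraph w t).numComponents : ℝ) =
      ∑ A ∈ G.spanningSubgraphs,
        (A.numComponents : ℝ) * ∏ e : G.edgeSet, A.edgeIndicator e (w e) t := by
  rw [Finset.sum_eq_single (G.sublevelGraph w t)]
  · rw [prod_edgeIndicator G w t (G.sublevelGraph_le w t), if_pos rfl, mul_one]
  · intro A hA hne
    rw [prod_edgeIndicator G w t (by simpa [spanningSubgraphs] using hA), if_neg hne, mul_zero]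
  · intro h
    exact absurd (by simpa [spanningSubgraphs] using G.sublevelGraph_le w t) h

/-- The joint law of independent uniform edge lengths. -/
noncomputable def uniformLengths (G : SimpleGraph V) : Measure (G.edgeSet → ℝ) :=
  Measure.pi fun _ => volume.restrict (Set.Icc (0 : ℝ) 1)

instance isProbabilityMeasure_restrict_Icc_zero_one :
    IsProbabilityMeasure (volume.restrict (Set.Icc (0 : ℝ) 1)) :=
  ⟨by simp⟩

instance (G : SimpleGraph V) : IsProbabilityMeasure G.uniformLengths := by
  unfold uniformLengths; infer_instance

theorem measurable_prod_edgeIndicator (G A : SimpleGraph V) :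
    Measurable fun q : (G.edgeSet → ℝ) × ℝ =>
      ∏ e : G.edgeSet, A.edgeIndicator e (q.1 e) q.2 :=
  Finset.measurable_prod _ fun e _ =>
    (A.measurable_edgeIndicator e).comp (by fun_prop :
      Measurable fun q : (G.edgeSet → ℝ) × ℝ => (q.1 e, q.2))

theorem norm_prod_edgeIndicator_le (G A : SimpleGraph V) (w : G.edgeSet → ℝ) (t : ℝ) :
    ‖∏ e : G.edgeSet, A.edgeIndicator e (w e) t‖ ≤ 1 := by
  rw [norm_prod]
  exact Finset.prod_le_one (fun _ _ => norm_nonneg _) fun e _ => A.norm_edgeIndicator_le e _ _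

theorem integral_prod_edgeIndicator (G : SimpleGraph V) {A : SimpleGraph V} (hA : A ≤ G) {t : ℝ}
    (ht : t ∈ Set.Icc (0 : ℝ) 1) :
    ∫ w, ∏ e : G.edgeSet, A.edgeIndicator e (w e) t ∂G.uniformLengths =
      t ^ A.numEdges * (1 - t) ^ (G.numEdges - A.numEdges) := by
  rw [uniformLengths,
    integral_fintype_prod_eq_prod (f := fun (e : G.edgeSet) x => A.edgeIndicator e x t)]
  simp only [integral_edgeIndicator A _ ht]
  have hcard : (Finset.univ.filter fun e : G.edgeSet => (e : Sym2 V) ∈ A.edgeSet).card =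
      A.numEdges := by
    rw [numEdges, ← Set.ncard_coe_finset, ← Set.ncard_image_of_injective _ Subtype.val_injective]
    congr 1
    ext z
    simp only [Set.mem_image, Finset.mem_coe, Finset.mem_filter, Finset.mem_univ, true_and]
    exact ⟨by rintro ⟨e, he, rfl⟩; exact he, fun hz => ⟨⟨z, edgeSet_mono hA hz⟩, hz, rfl⟩⟩
  have hG : Fintype.card G.edgeSet = G.numEdges := by
    rw [numEdges, Set.ncard_eq_toFinset_card', Set.toFinset_card]
  rw [Finset.prod_ite, Finset.prod_const, Finset.prod_const, hcard, Finset.filter_not,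
    Finset.card_sdiff_of_subset (Finset.filter_subset _ _), Finset.card_univ, hcard, hG]

theorem integrable_numComponents_sublevelGraph (G : SimpleGraph V) :
    Integrable (fun q : (G.edgeSet → ℝ) × ℝ => ((G.sublevelGraph q.1 q.2).numComponents : ℝ) - 1)
      (G.uniformLengths.prod (volume.restrict (Set.Icc (0 : ℝ) 1))) := by
  simp only [numComponents_sublevelGraph_eq_sum]
  refine Integrable.sub (integrable_finsetSum _ fun A _ => Integrable.const_mul ?_ _)
    (integrable_const _)
  exact Integrable.of_bound (C := 1) (G.measurable_prod_edgeIndicator A).aestronglyMeasurable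
    (.of_forall fun q => G.norm_prod_edgeIndicator_le A q.1 q.2)

/-- The expected number of components of the sublevel graph. -/
theorem integral_numComponents_sublevelGraph (G : SimpleGraph V) {t : ℝ}
    (ht : t ∈ Set.Icc (0 : ℝ) 1) :
    ∫ w, (((G.sublevelGraph w t).numComponents : ℝ) - 1) ∂G.uniformLengths =
      G.mstPolynomial.eval t := by
  have hint : ∀ A : SimpleGraph V, Integrable (fun w : G.edgeSet → ℝ => (A.numComponents : ℝ) *
      ∏ e : G.edgeSet, A.edgeIndicator e (w e) t) G.uniformLengths := fun A =>
    (Integrable.of_bound (C := 1)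
      ((G.measurable_prod_edgeIndicator A).comp measurable_prodMk_right).aestronglyMeasurable
      (.of_forall fun w => G.norm_prod_edgeIndicator_le A w t)).const_mul _
  simp only [numComponents_sublevelGraph_eq_sum]
  rw [integral_sub (integrable_finsetSum _ fun A _ => hint A) (integrable_const _),
    integral_finsetSum _ fun A _ => hint A]
  simp only [integral_const, probReal_univ, smul_eq_mul, mul_one, mstPolynomial, eval_sub,
    eval_finsetSum, eval_mul, eval_C, eval_pow, eval_X, eval_one]
  congr 1
  refine Finset.sum_congr rfl fun A hA => ?_
  rw [integral_const_mul, integral_prod_edgeIndicator G (by simpa [spanningSubgraphs] using hA) ht,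
    mul_assoc]

theorem ae_uniformLengths_mem_Icc (G : SimpleGraph V) :
    ∀ᵐ w ∂G.uniformLengths, ∀ e, w e ∈ Set.Icc (0 : ℝ) 1 := by
  refine ae_all_iff.2 fun e => ?_
  exact (Measure.quasiMeasurePreserving_eval _ e).ae (ae_restrict_mem measurableSet_Icc)

theorem mstLength_ae_eq_integral (G : SimpleGraph V) (hG : G.Connected) :
    G.mstLength hG =ᵐ[G.uniformLengths] fun w =>
      ∫ t in Set.Icc (0 : ℝ) 1, (((G.sublevelGraph w t).numComponents : ℝ) - 1) := by
  filter_upwards [G.ae_uniformLengths_mem_Icc] with w hw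
  exact G.mstLength_eq_integral hG hw

/-- `mstLength` is defined through a choice of tree; its measurability is obtained from the almost
everywhere equality with a partial integral of a jointly integrable function. -/
theorem integrable_mstLength (G : SimpleGraph V) (hG : G.Connected) :
    Integrable (G.mstLength hG) G.uniformLengths :=
  (integrable_congr (G.mstLength_ae_eq_integral hG)).2
    G.integrable_numComponents_sublevelGraph.integral_prod_left

theorem integral_mstLength (G : SimpleGraph V) (hG : G.Connected) :
    ∫ w, G.mstLength hG w ∂G.uniformLengths = ∫ t in (0 : ℝ)..1, G.mstPolynomial.eval t := by
  rw [integral_congr_ae (G.mstLength_ae_eq_integral hG),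
    integral_integral_swap G.integrable_numComponents_sublevelGraph,
    intervalIntegral.integral_of_le zero_le_one, ← integral_Icc_eq_integral_Ioc]
  exact setIntegral_congr_fun measurableSet_Icc fun t ht =>
    G.integral_numComponents_sublevelGraph ht

theorem map_eq_uniformLengths (G : SimpleGraph V) {Ω : Type*} [MeasurableSpace Ω] {P : Measure Ω}
    [IsProbabilityMeasure P] {ξ : G.edgeSet → Ω → ℝ} (hindep : ProbabilityTheory.iIndepFun ξ P)
    (hξ : ∀ e, AEMeasurable (ξ e) P)
    (hunif : ∀ e, pdf.IsUniform (ξ e) (Set.Icc (0 : ℝ) 1) P volume) :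
    P.map (fun ω e => ξ e ω) = G.uniformLengths := by
  rw [(ProbabilityTheory.iIndepFun_iff_map_fun_eq_pi_map hξ).1 hindep, uniformLengths]
  congr 1
  funext e
  -- The normalising factor is the inverse of the volume of `[0,1]`, which is `1`.
  rw [hunif e, ProbabilityTheory.cond]
  simp

end Expectation

end SimpleGraph

theorem mainTheorem1 {V : Type*} [Fintype V] (G : SimpleGraph V) (hG : G.Connected)
    {Ω : Type*} [MeasurableSpace Ω] (P : MeasureTheory.Measure Ω)
    [MeasureTheory.IsProbabilityMeasure P]
    (ξ : G.edgeSet → Ω → ℝ) (hindep : ProbabilityTheory.iIndepFun ξ P)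
    (hunif : ∀ e, MeasureTheory.pdf.IsUniform (ξ e) (Set.Icc (0 : ℝ) 1) P
      MeasureTheory.volume) :
    MeasureTheory.Integrable (fun ω => G.mstLength hG (fun e => ξ e ω)) P ∧
    (∫ ω, G.mstLength hG (fun e => ξ e ω) ∂P) = (∫ t in (0 : ℝ)..1, G.mstPolynomial.eval t) ∧
    G.mstPolynomial.natDegree ≤ G.numEdges ∧
    G.mstPolynomial =
      -1 + ∑ i ∈ Finset.range (G.numEdges + 1),
        Polynomial.C (G.mstCoeff i) * Polynomial.X ^ i := by
  -- The push-forward along a map that is not a.e. measurable is `0` by convention, whereas the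
  -- uniform law is nonzero because `[0,1]` has finite nonzero volume.
  have hξ : ∀ e, AEMeasurable (ξ e) P := fun e => (hunif e).aemeasurable (by simp) (by simp)
  have hvec : AEMeasurable (fun ω e => ξ e ω) P := aemeasurable_pi_iff.2 hξ
  have hlaw := G.map_eq_uniformLengths hindep hξ hunif
  have hint := G.integrable_mstLength hG
  rw [← hlaw] at hint
  refine ⟨hint.comp_aemeasurable hvec, ?_, G.natDegree_mstPolynomial_le, G.mstPolynomial_eq⟩
  rw [← G.integral_mstLength hG, ← hlaw,
    MeasureTheory.integral_map hvec hint.aestronglyMeasurable]
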